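/- Let $A\in\mathbb R^{n\times n}$. Call $A$ stable if all its (complex) eigenvalues $\lambda$ satisfy $|\lambda|\le 1$ and every eigenvalue with $|\lambda|=1$ is semisimple (its algebraic and geometric multiplicities coincide), and asymptotically stable if all its eigenvalues satisfy $|\lambda|<1$. Call $(S,U,B)$ with $S,U,B\in\mathbb R^{n\times n}$ a SUB form of $A$ if $A=S^{-1}UBS$, where $S$ is symmetric positive definite, $U$ is orthogonal, $B$ is symmetric positive semidefinite, and $\|B\|\le 1$; here $\|\cdot\|$ is the spectral norm. Then $A$ is stable if and only if it admits a SUB form, and $A$ is asymptotically stable if and only if it admits a SUB form with $\|B\|<1$. -/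

import Mathlib

open scoped Matrix.Norms.L2Operator

namespace DiscreteTime

/-- The endomorphism of `ℂⁿ` given by a real square matrix; the eigenvalues of a real
matrix are its complex eigenvalues, that is, those of this endomorphism. -/
noncomputable def complexEnd {n : ℕ} (A : Matrix (Fin n) (Fin n) ℝ) :
    Module.End ℂ (Fin n → ℂ) :=
  Matrix.toLin' (A.map (algebraMap ℝ ℂ))

/-- `μ` is a semisimple eigenvalue of `A`: every generalized eigenvector for `μ` is an
eigenvector, so the algebraic and geometric multiplicities agree. -/
def IsSemisimpleEigenvalue {n : ℕ} (A : Matrix (Fin n) (Fin n) ℝ) (μ : ℂ) : Prop :=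
  (complexEnd A).HasEigenvalue μ ∧
    (complexEnd A).maxGenEigenspace μ = (complexEnd A).eigenspace μ

/-- Stability of the system `x (t + 1) = A x (t)`: all eigenvalues have modulus at most one,
and those of modulus one are semisimple. -/
def IsStable {n : ℕ} (A : Matrix (Fin n) (Fin n) ℝ) : Prop :=
  ∀ μ : ℂ, (complexEnd A).HasEigenvalue μ →
    ‖μ‖ ≤ 1 ∧ (‖μ‖ = 1 → IsSemisimpleEigenvalue A μ)

/-- Asymptotic stability: all eigenvalues have modulus less than one (the condition on
eigenvalues of modulus one is then void). -/
def IsAsymptoticallyStable {n : ℕ} (A : Matrix (Fin n) (Fin n) ℝ) : Prop :=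
  ∀ μ : ℂ, (complexEnd A).HasEigenvalue μ → ‖μ‖ < 1

/-- `(S, U, B)` is a SUB form of `A`. The norm is the spectral norm, the operator norm
induced by the Euclidean norm; `Matrix.PosDef` and `Matrix.PosSemidef` include symmetry. -/
structure IsSUBForm {n : ℕ} (A S U B : Matrix (Fin n) (Fin n) ℝ) : Prop where
  posDef : S.PosDef
  orthogonal : U ∈ Matrix.orthogonalGroup (Fin n) ℝ
  posSemidef : B.PosSemidef
  norm_le_one : ‖B‖ ≤ 1
  eq : A = S⁻¹ * U * B * S

end DiscreteTime

/-! A SUB form rewrites as `S * A = U * B * S`, so `A` contracts the Euclidean norm of `S x` by the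
factor `‖B‖`. The theorem is thus Lyapunov's: stability means that some quadratic norm is not
expanded, asymptotic stability that one is strictly contracted.

To build the norm, weight the powers of `T - μ` geometrically on each generalized eigenspace, so
that the nilpotent part costs little (`exists_weight_chain`), and sum over the eigenvalues. On real
vectors this is a form with a positive definite matrix `P`. With `S` the square root of `P`, the
polar decomposition of `S * A * S⁻¹` gives `U` and `B`.

Conversely, a contracted norm bounds every eigenvalue, and a nontrivial Jordan chain on the unit
circle would have linearly growing orbits (`genEigenvector_eq_of_contraction`). -/

namespace DiscreteTime

/-! ### Contracted norms from generalized eigenspaces -/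

section Adapted

theorem normSq_add_le_weighted {E : Type*} [SeminormedAddCommGroup E] (u v : E) {δ : ℝ}
    (hδ : 0 < δ) : ‖u + v‖ ^ 2 ≤ (1 + δ) * ‖u‖ ^ 2 + (1 + 1 / δ) * ‖v‖ ^ 2 := by
  have h1 : ‖u + v‖ ^ 2 ≤ (‖u‖ + ‖v‖) ^ 2 := by gcongr; exact norm_add_le u v
  have h2 : (1 + δ) * ‖u‖ ^ 2 + (1 + 1 / δ) * ‖v‖ ^ 2 - (‖u‖ + ‖v‖) ^ 2
      = (δ * ‖u‖ - ‖v‖) ^ 2 / δ := by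
    field_simp
    ring
  have h3 : 0 ≤ (δ * ‖u‖ - ‖v‖) ^ 2 / δ := by positivity
  linarith

/-- A Jordan chain `y` for an eigenvalue `μ` in the open unit disc is strictly contracted in a
suitably weighted norm. -/
theorem exists_weight_chain {E : Type*} [SeminormedAddCommGroup E] [NormedSpace ℂ E] {μ : ℂ}
    (hμ : ‖μ‖ < 1) :
    ∃ r : ℝ, 0 < r ∧ ∃ c : ℝ, 0 ≤ c ∧ c < 1 ∧ ∀ (d : ℕ) (y : ℕ → E), y d = 0 →
      ∑ j ∈ Finset.range d, (r ^ j) ^ 2 * ‖μ • y j + y (j + 1)‖ ^ 2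
        ≤ c * ∑ j ∈ Finset.range d, (r ^ j) ^ 2 * ‖y j‖ ^ 2 := by
  set a : ℝ := ‖μ‖ ^ 2 with ha
  have ha0 : 0 ≤ a := by positivity
  have ha1 : a < 1 := by
    have := norm_nonneg μ
    nlinarith
  -- This makes `a + 2 * δ = (1 + a) / 2 < 1`. The ratio `R` satisfies `1 + 1 / δ = δ * R`, so the
  -- next weight absorbs the off-diagonal term at cost `δ`.
  set δ : ℝ := (1 - a) / 4 with hδ
  have hδ0 : 0 < δ := by linarith
  set R : ℝ := (1 + 1 / δ) / δ with hR
  have hR0 : 0 < R := by positivity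
  refine ⟨√R, Real.sqrt_pos.2 hR0, a + 2 * δ, by positivity, by linarith, fun d y hy => ?_⟩
  have hpow : ∀ j : ℕ, (√R ^ j) ^ 2 = R ^ j := fun j => by
    rw [← pow_mul, mul_comm, pow_mul, Real.sq_sqrt hR0.le]
  simp only [hpow]
  have hRδ : 1 + 1 / δ = δ * R := by
    rw [hR]; field_simp
  have hshift : ∑ j ∈ Finset.range d, R ^ (j + 1) * ‖y (j + 1)‖ ^ 2
      ≤ ∑ j ∈ Finset.range d, R ^ j * ‖y j‖ ^ 2 := by
    have h := Finset.sum_range_succ (fun j => R ^ j * ‖y j‖ ^ 2) d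
    rw [Finset.sum_range_succ'] at h
    simp only [hy, norm_zero] at h
    have : 0 ≤ R ^ 0 * ‖y 0‖ ^ 2 := by positivity
    nlinarith
  calc ∑ j ∈ Finset.range d, R ^ j * ‖μ • y j + y (j + 1)‖ ^ 2
      ≤ ∑ j ∈ Finset.range d, ((a + δ) * (R ^ j * ‖y j‖ ^ 2)
          + δ * (R ^ (j + 1) * ‖y (j + 1)‖ ^ 2)) := by
        refine Finset.sum_le_sum fun j _ => ?_
        have h := normSq_add_le_weighted (μ • y j) (y (j + 1)) hδ0
        rw [norm_smul, mul_pow, ← ha, hRδ] at h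
        have h' : (1 + δ) * (a * ‖y j‖ ^ 2) ≤ (a + δ) * ‖y j‖ ^ 2 := by
          have : 0 ≤ δ * (1 - a) * ‖y j‖ ^ 2 :=
            mul_nonneg (mul_nonneg hδ0.le (by linarith)) (by positivity)
          nlinarith
        have hRj : 0 ≤ R ^ j := by positivity
        calc R ^ j * ‖μ • y j + y (j + 1)‖ ^ 2
            ≤ R ^ j * ((a + δ) * ‖y j‖ ^ 2 + δ * R * ‖y (j + 1)‖ ^ 2) := by
              gcongr; linarith
          _ = _ := by ring
    _ = (a + δ) * ∑ j ∈ Finset.range d, R ^ j * ‖y j‖ ^ 2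
          + δ * ∑ j ∈ Finset.range d, R ^ (j + 1) * ‖y (j + 1)‖ ^ 2 := by
        rw [Finset.sum_add_distrib, Finset.mul_sum, Finset.mul_sum]
    _ ≤ _ := by nlinarith

variable {V E : Type*} [AddCommGroup V] [Module ℂ V] [FiniteDimensional ℂ V]
  [SeminormedAddCommGroup E] [NormedSpace ℂ E]

/-- Inside the disc, the vectors `φ ((T - μ) ^ j x)` form a terminating chain to which
`exists_weight_chain` applies. On the circle, semisimplicity makes `T` act as the scalar `μ`, which
preserves every norm. -/
theorem exists_weight_maxGenEigenspace (T : Module.End ℂ V) (φ : V →ₗ[ℂ] E) {μ : ℂ}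
    (hμ : ‖μ‖ ≤ 1) (hss : ‖μ‖ = 1 → T.maxGenEigenspace μ = T.eigenspace μ) :
    ∃ r : ℝ, 0 < r ∧ ∃ c : ℝ, 0 ≤ c ∧ c ≤ 1 ∧ (‖μ‖ < 1 → c < 1) ∧
      ∀ x ∈ T.maxGenEigenspace μ,
        ∑ j ∈ Finset.range (Module.finrank ℂ V + 1),
            (r ^ j) ^ 2 * ‖φ (((T - algebraMap ℂ _ μ) ^ j) (T x))‖ ^ 2
          ≤ c * ∑ j ∈ Finset.range (Module.finrank ℂ V + 1),
            (r ^ j) ^ 2 * ‖φ (((T - algebraMap ℂ _ μ) ^ j) x)‖ ^ 2 := by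
  have hstep : ∀ (j : ℕ) (x : V), φ (((T - algebraMap ℂ _ μ) ^ j) (T x))
      = μ • φ (((T - algebraMap ℂ _ μ) ^ j) x)
        + φ (((T - algebraMap ℂ _ μ) ^ (j + 1)) x) := by
    intro j x
    rw [pow_succ, Module.End.mul_apply, ← map_smul, ← map_add, ← map_smul, ← map_add]
    simp
  rcases hμ.lt_or_eq with h | h
  · obtain ⟨r, hr, c, hc0, hc1, hrc⟩ := exists_weight_chain (E := E) h
    refine ⟨r, hr, c, hc0, hc1.le, fun _ => hc1, fun x hx => ?_⟩
    simp only [hstep]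
    refine hrc _ (fun j => φ (((T - algebraMap ℂ _ μ) ^ j) x)) ?_
    rw [T.maxGenEigenspace_eq_genEigenspace_finrank μ, Module.End.mem_genEigenspace_nat,
      LinearMap.mem_ker] at hx
    have : ((T - algebraMap ℂ _ μ) ^ Module.finrank ℂ V) x = 0 := hx
    change φ (((T - algebraMap ℂ _ μ) ^ (Module.finrank ℂ V + 1)) x) = 0
    rw [pow_succ', Module.End.mul_apply, this, map_zero, map_zero]
  · refine ⟨1, one_pos, 1, zero_le_one, le_rfl, fun h' => absurd h' h.not_lt, fun x hx => ?_⟩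
    rw [hss h, Module.End.mem_eigenspace_iff] at hx
    simp [hx, norm_smul, h]

open scoped Classical in
/-- The projections onto the generalized eigenspaces. -/
theorem exists_spectral_projections (T : Module.End ℂ V) :
    ∃ p : ℂ → V →ₗ[ℂ] V, (∀ μ x, p μ x ∈ T.maxGenEigenspace μ) ∧
      (∀ μ x, p μ (T x) = T (p μ x)) ∧ ∀ x, (∀ μ, p μ x = 0) → x = 0 := by
  have hint : DirectSum.IsInternal fun μ : ℂ => T.maxGenEigenspace μ :=
    DirectSum.isInternal_submodule_of_iSupIndep_of_iSup_eq_top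
      T.independent_maxGenEigenspace (Module.End.iSup_maxGenEigenspace_eq_top T)
  let _ := hint.chooseDecomposition
  refine ⟨fun μ => (T.maxGenEigenspace μ).subtype ∘ₗ
    DirectSum.component ℂ ℂ (fun μ => T.maxGenEigenspace μ) μ ∘ₗ
      (DirectSum.decomposeLinearEquiv fun μ => T.maxGenEigenspace μ).toLinearMap,
    fun μ x => Subtype.prop _, fun μ x => ?_, fun x hx => ?_⟩
  · change (DirectSum.decompose (fun μ => T.maxGenEigenspace μ) (T x) μ : V)
      = T (DirectSum.decompose (fun μ => T.maxGenEigenspace μ) x μ)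
    induction x using DirectSum.Decomposition.inductionOn (fun μ => T.maxGenEigenspace μ) with
    | zero => simp
    | @homogeneous ν m =>
      have hm : T m ∈ T.maxGenEigenspace ν :=
        Module.End.mapsTo_maxGenEigenspace_of_comm (Commute.refl T) ν m.2
      by_cases h : ν = μ
      · subst h
        rw [DirectSum.decompose_of_mem_same _ hm, DirectSum.decompose_of_mem_same _ m.2]
      · rw [DirectSum.decompose_of_mem_ne _ hm h, DirectSum.decompose_of_mem_ne _ m.2 h, map_zero]
    | add a b ha hb => simp [ha, hb]
  · apply (DirectSum.decompose fun μ => T.maxGenEigenspace μ).injective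
    rw [DirectSum.decompose_zero]
    ext μ
    exact hx μ

/-- An endomorphism with spectrum in the closed unit disc and semisimple peripheral spectrum
contracts a sum of squares of norms of linear maps that jointly separate points. -/
theorem exists_contracted_sum_normSq (T : Module.End ℂ V) (φ : V →ₗ[ℂ] E)
    (hφ : ∀ x, φ x = 0 → x = 0)
    (hT : ∀ μ, T.HasEigenvalue μ →
      ‖μ‖ ≤ 1 ∧ (‖μ‖ = 1 → T.maxGenEigenspace μ = T.eigenspace μ)) :
    ∃ (s : Finset (ℂ × ℕ)) (L : ℂ × ℕ → V →ₗ[ℂ] E) (c : ℝ), 0 ≤ c ∧ c ≤ 1 ∧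
      ((∀ μ, T.HasEigenvalue μ → ‖μ‖ < 1) → c < 1) ∧
      (∀ x, ∑ i ∈ s, ‖L i (T x)‖ ^ 2 ≤ c * ∑ i ∈ s, ‖L i x‖ ^ 2) ∧
      ∀ x, (∀ i ∈ s, L i x = 0) → x = 0 := by
  obtain ⟨p, hp, hpT, hp0⟩ := exists_spectral_projections T
  have hfin : {μ | T.HasEigenvalue μ}.Finite := T.finite_hasEigenvalue
  set e := hfin.toFinset with he
  have hmem : ∀ μ, μ ∈ e ↔ T.HasEigenvalue μ := fun μ => by simp [he]
  choose! r hr c hc0 hc1 hc2 hrc using fun μ (h : T.HasEigenvalue μ) =>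
    exists_weight_maxGenEigenspace T φ (hT μ h).1 (hT μ h).2
  set d := Module.finrank ℂ V + 1 with hd
  -- Taken in `NNReal`, the supremum is `0` when there are no eigenvalues, so `C < 1` survives in
  -- dimension zero.
  set C : NNReal := e.sup fun μ => (c μ).toNNReal
  have hcC : ∀ μ ∈ e, c μ ≤ C := fun μ hμ =>
    (Real.le_coe_toNNReal _).trans
      (NNReal.coe_le_coe.2 (Finset.le_sup (f := fun μ => (c μ).toNNReal) hμ))
  refine ⟨e ×ˢ Finset.range d,
    fun i => ((r i.1 ^ i.2 : ℝ) : ℂ) • (φ ∘ₗ ((T - algebraMap ℂ _ i.1) ^ i.2) ∘ₗ p i.1), C,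
    C.2, ?_, fun h => ?_, fun x => ?_, fun x hx => ?_⟩
  · refine NNReal.coe_le_one.2 (Finset.sup_le fun μ hμ => ?_)
    exact Real.toNNReal_le_one.2 (hc1 μ ((hmem μ).1 hμ))
  · refine NNReal.coe_lt_one.2 ((Finset.sup_lt_iff zero_lt_one).2 fun μ hμ => ?_)
    exact Real.toNNReal_lt_one.2 (hc2 μ ((hmem μ).1 hμ) (h μ ((hmem μ).1 hμ)))
  · simp only [Finset.sum_product, LinearMap.smul_apply, LinearMap.comp_apply, norm_smul, mul_pow,
      Complex.norm_real, Real.norm_eq_abs, sq_abs, hpT]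
    rw [Finset.mul_sum]
    refine Finset.sum_le_sum fun μ hμ => (hrc μ ((hmem μ).1 hμ) _ (hp μ x)).trans ?_
    exact mul_le_mul_of_nonneg_right (hcC μ hμ) (Finset.sum_nonneg fun _ _ => by positivity)
  · refine hp0 x fun μ => ?_
    by_cases hμ : T.HasEigenvalue μ
    · have h := hx (μ, 0) (by simp [hmem, hμ, hd])
      exact hφ _ (by simpa using h)
    · have hbot : T.maxGenEigenspace μ = ⊥ := by
        rw [T.maxGenEigenspace_eq_genEigenspace_finrank μ]
        by_contra hne
        exact hμ (Module.End.hasEigenvalue_of_hasGenEigenvalue hne)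
      simpa [hbot] using hp μ x

end Adapted

/-! ### Descent to a real quadratic form -/

section RealForm

open Matrix

variable {n : ℕ}

/-- `q` is the quadratic form of a real positive semidefinite matrix. -/
def IsPSDForm (q : (Fin n → ℝ) → ℝ) : Prop :=
  ∃ P : Matrix (Fin n) (Fin n) ℝ, P.PosSemidef ∧ ∀ x, x ⬝ᵥ (P *ᵥ x) = q x

theorem IsPSDForm.sum {ι : Type*} {s : Finset ι} {q : ι → (Fin n → ℝ) → ℝ}
    (h : ∀ i ∈ s, IsPSDForm (q i)) : IsPSDForm fun x => ∑ i ∈ s, q i x := by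
  choose! P hP hq using h
  refine ⟨∑ i ∈ s, P i, Matrix.posSemidef_sum s hP, fun x => ?_⟩
  rw [Matrix.sum_mulVec, dotProduct_sum]
  exact Finset.sum_congr rfl fun i hi => hq i hi x

theorem IsPSDForm.add {q₁ q₂ : (Fin n → ℝ) → ℝ} (h₁ : IsPSDForm q₁) (h₂ : IsPSDForm q₂) :
    IsPSDForm fun x => q₁ x + q₂ x := by
  obtain ⟨P₁, hP₁, h₁⟩ := h₁
  obtain ⟨P₂, hP₂, h₂⟩ := h₂
  exact ⟨P₁ + P₂, hP₁.add hP₂, fun x => by rw [add_mulVec, dotProduct_add, h₁, h₂]⟩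

theorem isPSDForm_sq (l : (Fin n → ℝ) →ₗ[ℝ] ℝ) : IsPSDForm fun x => l x ^ 2 := by
  set a : Fin n → ℝ := fun i => l (Pi.single i 1) with ha
  have hl : ∀ x, l x = a ⬝ᵥ x := fun x => by
    rw [LinearMap.pi_apply_eq_sum_univ l x]
    refine Finset.sum_congr rfl fun i _ => ?_
    rw [smul_eq_mul, mul_comm, ha]
    congr 2
    ext j
    simp [Pi.single_apply, eq_comm]
  refine ⟨vecMulVec a (star a), posSemidef_vecMulVec_self_star a, fun x => ?_⟩
  simp only [vecMulVec_mulVec, hl, star_trivial, dotProduct_smul, dotProduct_comm x a]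
  simp [sq]

/-- On real vectors, the real and imaginary parts of each coordinate of `L` are real linear
functionals, and the squared norm is the sum of their squares. -/
theorem isPSDForm_normSq (L : (Fin n → ℂ) →ₗ[ℂ] EuclideanSpace ℂ (Fin n)) :
    IsPSDForm fun x => ‖L (fun i => (x i : ℂ))‖ ^ 2 := by
  let M : (Fin n → ℝ) →ₗ[ℝ] EuclideanSpace ℂ (Fin n) :=
    L.restrictScalars ℝ ∘ₗ Complex.ofRealCLM.toLinearMap.compLeft (Fin n)
  have h : ∀ x : Fin n → ℝ, ‖L (fun i => (x i : ℂ))‖ ^ 2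
      = ∑ i, ((L (fun i => (x i : ℂ)) i).re ^ 2 + (L (fun i => (x i : ℂ)) i).im ^ 2) := fun x => by
    rw [EuclideanSpace.norm_sq_eq]
    refine Finset.sum_congr rfl fun i _ => ?_
    rw [Complex.sq_norm, Complex.normSq_apply, sq, sq]
  simp only [h]
  refine IsPSDForm.sum fun i _ => IsPSDForm.add ?_ ?_
  · exact isPSDForm_sq (Complex.reLm ∘ₗ
      (EuclideanSpace.proj (𝕜 := ℂ) i).toLinearMap.restrictScalars ℝ ∘ₗ M)
  · exact isPSDForm_sq (Complex.imLm ∘ₗ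
      (EuclideanSpace.proj (𝕜 := ℂ) i).toLinearMap.restrictScalars ℝ ∘ₗ M)

theorem complexEnd_ofReal (A : Matrix (Fin n) (Fin n) ℝ) (x : Fin n → ℝ) :
    complexEnd A (fun i => (x i : ℂ)) = fun i => (((A *ᵥ x) i : ℝ) : ℂ) := by
  ext i
  simp [complexEnd, mulVec, dotProduct]

/-- Lyapunov's theorem for discrete-time systems. -/
theorem IsStable.exists_posDef {A : Matrix (Fin n) (Fin n) ℝ} (hA : IsStable A) :
    ∃ (P : Matrix (Fin n) (Fin n) ℝ) (c : ℝ), P.PosDef ∧ 0 ≤ c ∧ c ≤ 1 ∧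
      (IsAsymptoticallyStable A → c < 1) ∧
      ∀ x, (A *ᵥ x) ⬝ᵥ (P *ᵥ (A *ᵥ x)) ≤ c * (x ⬝ᵥ (P *ᵥ x)) := by
  obtain ⟨s, L, c, hc0, hc1, hc, hle, hinj⟩ :=
    exists_contracted_sum_normSq (complexEnd A)
      (WithLp.linearEquiv 2 ℂ (Fin n → ℂ)).symm.toLinearMap
      (fun x hx => by simpa using hx) fun μ hμ => ⟨(hA μ hμ).1, fun h => ((hA μ hμ).2 h).2⟩
  obtain ⟨P, hP, hq⟩ := IsPSDForm.sum (s := s) fun i _ => isPSDForm_normSq (L i)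
  refine ⟨P, c, posDef_iff_dotProduct_mulVec.2 ⟨hP.isHermitian, fun x hx => ?_⟩, hc0, hc1, hc,
    fun x => ?_⟩
  · rw [star_trivial, hq]
    refine (Finset.sum_nonneg fun _ _ => by positivity).lt_of_ne' fun h0 => hx ?_
    rw [Finset.sum_eq_zero_iff_of_nonneg fun _ _ => by positivity] at h0
    have := hinj (fun i => (x i : ℂ)) fun i hi => by simpa using h0 i hi
    ext i
    simpa using congrFun this i
  · simp only [hq, ← complexEnd_ofReal]
    exact hle _

end RealForm

/-! ### Polar decomposition and construction of the SUB form -/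

section Polar

open Matrix
open scoped MatrixOrder

variable {n : ℕ}

theorem norm_toLp_mulVec_sq (M : Matrix (Fin n) (Fin n) ℝ) (x : Fin n → ℝ) :
    ‖WithLp.toLp 2 (M *ᵥ x)‖ ^ 2 = x ⬝ᵥ ((Mᵀ * M) *ᵥ x) := by
  rw [EuclideanSpace.real_norm_sq_eq, ← mulVec_mulVec, dotProduct_mulVec, vecMul_transpose]
  simp [dotProduct, sq]

theorem mem_orthogonalGroup_of_linearIsometry
    (u : EuclideanSpace ℝ (Fin n) →ₗᵢ[ℝ] EuclideanSpace ℝ (Fin n)) :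
    (toEuclideanLin.symm u.toLinearMap : Matrix (Fin n) (Fin n) ℝ) ∈ orthogonalGroup (Fin n) ℝ := by
  set U : Matrix (Fin n) (Fin n) ℝ := toEuclideanLin.symm u.toLinearMap
  have hUu : toEuclideanLin U = u.toLinearMap := LinearEquiv.apply_symm_apply _ _
  have hcol : ∀ i k, u (EuclideanSpace.single i 1) k = U k i := fun i k => by
    change u.toLinearMap _ k = _
    rw [← hUu, toLpLin_apply]
    simp
  refine (mem_orthogonalGroup_iff' (Fin n) ℝ).2 (Matrix.ext fun i j => ?_)
  have h := u.inner_map_map (EuclideanSpace.single i 1) (EuclideanSpace.single j 1)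
  rw [EuclideanSpace.inner_single_left, PiLp.inner_apply] at h
  simp only [hcol] at h
  rw [mul_apply, one_apply]
  calc ∑ k, Uᵀ i k * U k j = ∑ k, inner ℝ (U k i) (U k j) :=
        Finset.sum_congr rfl fun k _ => mul_comm _ _
    _ = _ := h
    _ = _ := by simp

/-- Polar decomposition of a possibly singular real square matrix. -/
theorem exists_polar_decomposition (M : Matrix (Fin n) (Fin n) ℝ) :
    ∃ U ∈ orthogonalGroup (Fin n) ℝ, ∃ B : Matrix (Fin n) (Fin n) ℝ,
      B.PosSemidef ∧ M = U * B ∧ ‖B‖ = ‖M‖ := by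
  have hpsd : (Mᴴ * M).PosSemidef := posSemidef_conjTranspose_mul_self M
  set B := CFC.sqrt (Mᴴ * M)
  have hBB : B * B = Mᴴ * M := CFC.sqrt_mul_sqrt_self _ hpsd.nonneg
  have hBpsd : B.PosSemidef := (CFC.sqrt_nonneg (Mᴴ * M)).posSemidef
  have hBH : Bᴴ = B := hBpsd.isHermitian
  have hnorm : ∀ x, ‖toEuclideanLin B x‖ = ‖toEuclideanLin M x‖ := fun x => by
    rw [← sq_eq_sq₀ (norm_nonneg _) (norm_nonneg _), toLpLin_apply, toLpLin_apply,
      norm_toLp_mulVec_sq, norm_toLp_mulVec_sq, ← conjTranspose_eq_transpose_of_trivial,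
      ← conjTranspose_eq_transpose_of_trivial, hBH, hBB]
  let f := toEuclideanLin B
  let g := toEuclideanLin M
  have hker : LinearMap.ker f ≤ LinearMap.ker g := fun x hx => by
    rw [LinearMap.mem_ker] at hx ⊢
    rw [← norm_eq_zero, ← hnorm, norm_eq_zero]
    exact hx
  -- The map `B x ↦ M x` is well defined and isometric on the range of `B` because `‖B x‖ = ‖M x‖`.
  -- Extending it to the whole space handles singular `M`.
  let h₀ : LinearMap.range f →ₗ[ℝ] EuclideanSpace ℝ (Fin n) :=
    (LinearMap.ker f).liftQ g hker ∘ₗ f.quotKerEquivRange.symm.toLinearMap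
  have h₀f : ∀ x, h₀ ⟨f x, LinearMap.mem_range_self f x⟩ = g x := fun x => by
    have : f.quotKerEquivRange.symm ⟨f x, LinearMap.mem_range_self f x⟩
        = (LinearMap.ker f).mkQ x := by
      rw [LinearEquiv.symm_apply_eq]; rfl
    simp [h₀, this]
  let h₁ : LinearMap.range f →ₗᵢ[ℝ] EuclideanSpace ℝ (Fin n) :=
    ⟨h₀, by
      rintro ⟨_, x, rfl⟩
      rw [h₀f]
      exact (hnorm x).symm⟩
  let u := h₁.extend
  have hu : ∀ x, u (f x) = g x := fun x =>
    (h₁.extend_apply ⟨f x, LinearMap.mem_range_self f x⟩).trans (h₀f x)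
  let U : Matrix (Fin n) (Fin n) ℝ := toEuclideanLin.symm u.toLinearMap
  have hUu : toEuclideanLin U = u.toLinearMap := LinearEquiv.apply_symm_apply _ _
  refine ⟨U, ?_, B, hBpsd, ?_, ?_⟩
  · exact mem_orthogonalGroup_of_linearIsometry u
  · apply toEuclideanLin.injective
    ext x : 1
    rw [toLpLin_mul_same, hUu]
    exact (hu x).symm
  · have h := l2_opNorm_conjTranspose_mul_self B
    rw [hBH, hBB, l2_opNorm_conjTranspose_mul_self] at h
    nlinarith [norm_nonneg B, norm_nonneg M, mul_self_inj (norm_nonneg M) (norm_nonneg B)]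

theorem l2_opNorm_le_of_forall_sq {M : Matrix (Fin n) (Fin n) ℝ} {c : ℝ} (hc : 0 ≤ c)
    (h : ∀ x : Fin n → ℝ, x ⬝ᵥ ((Mᵀ * M) *ᵥ x) ≤ c * (x ⬝ᵥ x)) : ‖M‖ ≤ √c := by
  rw [l2_opNorm_def]
  refine ContinuousLinearMap.opNorm_le_bound _ (Real.sqrt_nonneg c) fun x => ?_
  rw [← sq_le_sq₀ (norm_nonneg _) (by positivity), mul_pow, Real.sq_sqrt hc]
  have hx : ‖x‖ ^ 2 = x.ofLp ⬝ᵥ x.ofLp := by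
    rw [EuclideanSpace.real_norm_sq_eq]; simp [dotProduct, sq]
  rw [hx]
  exact (norm_toLp_mulVec_sq M x.ofLp).trans_le (h x.ofLp)

/-- The square root `S` of `P` turns the form into the Euclidean norm, so `S * A * S⁻¹` has norm at
most `√c`, and its polar factor `B` has the same norm. -/
theorem exists_isSUBForm_of_posDef {A P : Matrix (Fin n) (Fin n) ℝ} {c : ℝ} (hP : P.PosDef)
    (hc0 : 0 ≤ c) (hc1 : c ≤ 1)
    (h : ∀ x, (A *ᵥ x) ⬝ᵥ (P *ᵥ (A *ᵥ x)) ≤ c * (x ⬝ᵥ (P *ᵥ x))) :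
    ∃ S U B : Matrix (Fin n) (Fin n) ℝ, IsSUBForm A S U B ∧ ‖B‖ ≤ √c := by
  set S := CFC.sqrt P
  have hSS : S * S = P := CFC.sqrt_mul_sqrt_self _ hP.posSemidef.nonneg
  have hSpsd : S.PosSemidef := (CFC.sqrt_nonneg P).posSemidef
  have hSunit : IsUnit S := by
    have := hP.isUnit
    rw [← hSS] at this
    exact isUnit_of_mul_isUnit_left this
  have hSdet : IsUnit S.det := (isUnit_iff_isUnit_det S).1 hSunit
  have hST : Sᵀ = S := hSpsd.isHermitian
  obtain ⟨U, hU, B, hB, hM, hBM⟩ := exists_polar_decomposition (S * A * S⁻¹)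
  have hn : ‖B‖ ≤ √c := by
    rw [hBM]
    refine l2_opNorm_le_of_forall_sq hc0 fun x => ?_
    have hx := h (S⁻¹ *ᵥ x)
    have hP' : ∀ y : Fin n → ℝ, y ⬝ᵥ (P *ᵥ y) = (S *ᵥ y) ⬝ᵥ (S *ᵥ y) := fun y => by
      rw [← hSS, ← mulVec_mulVec, dotProduct_mulVec, ← mulVec_transpose, hST]
    rw [hP', hP'] at hx
    simp only [mulVec_mulVec, mul_nonsing_inv S hSdet, one_mulVec] at hx
    rwa [← mulVec_mulVec, dotProduct_mulVec, vecMul_transpose, mul_assoc]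
  refine ⟨S, U, B, ⟨hSpsd.posDef_iff_isUnit.2 hSunit, hU, hB,
    hn.trans (Real.sqrt_le_one.2 hc1), ?_⟩, hn⟩
  rw [mul_assoc S⁻¹, ← hM, mul_assoc S⁻¹, mul_assoc (S * A), nonsing_inv_mul S hSdet, mul_one,
    ← mul_assoc, nonsing_inv_mul S hSdet, one_mul]

end Polar

/-! ### The norm contracted by a SUB form -/

section Converse

open Matrix

variable {n : ℕ}

theorem norm_toLp_map_mulVec_sq (M : Matrix (Fin n) (Fin n) ℝ) (v : Fin n → ℂ) :
    ‖WithLp.toLp 2 (M.map (algebraMap ℝ ℂ) *ᵥ v)‖ ^ 2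
      = ‖WithLp.toLp 2 (M *ᵥ fun i => (v i).re)‖ ^ 2
        + ‖WithLp.toLp 2 (M *ᵥ fun i => (v i).im)‖ ^ 2 := by
  simp only [EuclideanSpace.norm_sq_eq, ← Finset.sum_add_distrib]
  refine Finset.sum_congr rfl fun i _ => ?_
  rw [Complex.sq_norm, Complex.normSq_apply]
  simp [mulVec, dotProduct, sq]

/-- Real matrices act separately on real and imaginary parts, and squared norms add, so a real
inequality complexifies with the same constant. -/
theorem norm_toLp_map_mulVec_le {M N : Matrix (Fin n) (Fin n) ℝ} {ρ : ℝ} (hρ : 0 ≤ ρ)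
    (h : ∀ x : Fin n → ℝ, ‖WithLp.toLp 2 (M *ᵥ x)‖ ≤ ρ * ‖WithLp.toLp 2 (N *ᵥ x)‖)
    (v : Fin n → ℂ) :
    ‖WithLp.toLp 2 (M.map (algebraMap ℝ ℂ) *ᵥ v)‖
      ≤ ρ * ‖WithLp.toLp 2 (N.map (algebraMap ℝ ℂ) *ᵥ v)‖ := by
  rw [← sq_le_sq₀ (norm_nonneg _) (by positivity), mul_pow, norm_toLp_map_mulVec_sq,
    norm_toLp_map_mulVec_sq, mul_add, ← mul_pow, ← mul_pow]
  gcongr <;> exact h _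

theorem norm_toLp_orthogonal_mulVec {U : Matrix (Fin n) (Fin n) ℝ}
    (hU : U ∈ orthogonalGroup (Fin n) ℝ) (x : Fin n → ℝ) :
    ‖WithLp.toLp 2 (U *ᵥ x)‖ = ‖WithLp.toLp 2 x‖ := by
  have hU' : Uᵀ * U = 1 := (mem_orthogonalGroup_iff' (Fin n) ℝ).1 hU
  have h : (U *ᵥ x) ⬝ᵥ (U *ᵥ x) = x ⬝ᵥ x := by
    rw [dotProduct_mulVec, vecMul_mulVec, hU', vecMul_one]
  rw [← sq_eq_sq₀ (norm_nonneg _) (norm_nonneg _), EuclideanSpace.real_norm_sq_eq,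
    EuclideanSpace.real_norm_sq_eq]
  simpa [dotProduct, sq] using h

theorem IsSUBForm.exists_seminorm {A S U B : Matrix (Fin n) (Fin n) ℝ} (h : IsSUBForm A S U B) :
    ∃ φ : (Fin n → ℂ) →ₗ[ℂ] EuclideanSpace ℂ (Fin n), (∀ v, φ v = 0 → v = 0) ∧
      ∀ v, ‖φ (complexEnd A v)‖ ≤ ‖B‖ * ‖φ v‖ := by
  have hS : IsUnit S.det := (isUnit_iff_isUnit_det S).1 h.posDef.isUnit
  have hSA : S * A = U * B * S := by
    rw [h.eq, mul_assoc S⁻¹, mul_assoc S⁻¹, ← mul_assoc S, mul_nonsing_inv S hS, one_mul]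
  refine ⟨(WithLp.linearEquiv 2 ℂ (Fin n → ℂ)).symm.toLinearMap ∘ₗ
    toLin' (S.map (algebraMap ℝ ℂ)), fun v hv => ?_, fun v => ?_⟩
  · have hv' : S.map (algebraMap ℝ ℂ) *ᵥ v = 0 := by simpa using hv
    have hinv : S⁻¹.map (algebraMap ℝ ℂ) * S.map (algebraMap ℝ ℂ) = 1 := by
      rw [← Matrix.map_mul, nonsing_inv_mul S hS]
      simp
    rw [← one_mulVec v, ← hinv, ← mulVec_mulVec, hv', mulVec_zero]
  · have key := norm_toLp_map_mulVec_le (M := S * A) (N := S) (norm_nonneg B) (fun x => by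
      rw [hSA, mul_assoc, ← mulVec_mulVec, norm_toLp_orthogonal_mulVec h.orthogonal,
        ← mulVec_mulVec]
      exact l2_opNorm_mulVec B (WithLp.toLp 2 (S *ᵥ x))) v
    rw [Matrix.map_mul, ← mulVec_mulVec] at key
    exact key

end Converse

/-! ### Spectral consequences of a contracted norm -/

section Contraction

variable {V E : Type*} [AddCommGroup V] [Module ℂ V] [NormedAddCommGroup E] [NormedSpace ℂ E]
  {T : Module.End ℂ V} {φ : V →ₗ[ℂ] E} {ρ : ℝ}

theorem norm_eigenvalue_le (hφ : ∀ v, φ v = 0 → v = 0) (hT : ∀ v, ‖φ (T v)‖ ≤ ρ * ‖φ v‖)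
    {μ : ℂ} (hμ : T.HasEigenvalue μ) : ‖μ‖ ≤ ρ := by
  obtain ⟨v, hv⟩ := hμ.exists_hasEigenvector
  have h := hT v
  rw [hv.apply_eq_smul, map_smul, norm_smul] at h
  exact le_of_mul_le_mul_right h (norm_pos_iff.2 fun h0 => hv.2 (hφ v h0))

/-- A nontrivial Jordan chain for an eigenvalue on the unit circle has unbounded orbits. -/
theorem genEigenvector_eq_of_contraction (hφ : ∀ v, φ v = 0 → v = 0)
    (hT : ∀ v, ‖φ (T v)‖ ≤ ‖φ v‖) {μ : ℂ} (hμ : ‖μ‖ = 1) {u w : V} (hu : T u = μ • u)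
    (hw : T w = μ • w + u) : u = 0 := by
  -- Starting from `μ • w` instead of `w` gives the coefficient `k * μ ^ k` and avoids the exponent
  -- `k - 1`.
  have hiter : ∀ k : ℕ, (T ^ k) (μ • w) = μ ^ k • (μ • w) + (k * μ ^ k) • u := by
    intro k
    induction k with
    | zero => simp
    | succ k ih =>
      rw [pow_succ', Module.End.mul_apply, ih]
      simp only [map_add, map_smul, hw, hu]
      push_cast
      module
  have hbd : ∀ (k : ℕ) v, ‖φ ((T ^ k) v)‖ ≤ ‖φ v‖ := by
    intro k v
    induction k with
    | zero => simp
    | succ k ih =>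
      rw [pow_succ', Module.End.mul_apply]
      exact (hT _).trans ih
  by_contra hne
  have hpos : 0 < ‖φ u‖ := norm_pos_iff.2 fun h0 => hne (hφ u h0)
  -- Bounded orbits and the triangle inequality give `k * ‖φ u‖ ≤ 2 * ‖φ w‖`, which this `k`
  -- violates.
  obtain ⟨k, hk⟩ := exists_nat_gt (2 * ‖φ w‖ / ‖φ u‖)
  rw [div_lt_iff₀ hpos] at hk
  have h1 := hbd k (μ • w)
  rw [hiter] at h1
  simp only [map_add, map_smul] at h1
  have h2 := norm_sub_le (μ ^ k • μ • φ w + (k * μ ^ k) • φ u) (μ ^ k • μ • φ w)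
  rw [add_sub_cancel_left] at h2
  simp only [norm_smul, norm_mul, norm_pow, hμ, one_pow, one_mul, mul_one,
    Complex.norm_natCast] at h1 h2
  linarith

/-- Induction on the exponent killing `v`: the vector `u = (T - μ) v` lies in the eigenspace by
induction, so `v` and `u` form a chain of length two and `u = 0`. -/
theorem maxGenEigenspace_eq_eigenspace_of_contraction (hφ : ∀ v, φ v = 0 → v = 0)
    (hT : ∀ v, ‖φ (T v)‖ ≤ ‖φ v‖) {μ : ℂ} (hμ : ‖μ‖ = 1) :
    T.maxGenEigenspace μ = T.eigenspace μ := by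
  refine le_antisymm (fun v hv => ?_) Module.End.eigenspace_le_maxGenEigenspace
  obtain ⟨k, hk⟩ := (Module.End.mem_maxGenEigenspace T μ v).1 hv
  rw [Module.End.mem_eigenspace_iff]
  induction k generalizing v with
  | zero => simp_all
  | succ k ih =>
    have hv' : (T - μ • (1 : Module.End ℂ V)) v ∈ T.maxGenEigenspace μ :=
      (Module.End.mem_maxGenEigenspace T μ _).2 ⟨k, by rwa [pow_succ] at hk⟩
    have hu := ih _ hv' (by rwa [pow_succ] at hk)
    have h0 := genEigenvector_eq_of_contraction hφ hT hμ hu (w := v) (by simp)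
    simpa [sub_eq_zero] using h0

end Contraction

/-! ### Assembly of the two equivalences -/

section Main

variable {n : ℕ} {A S U B : Matrix (Fin n) (Fin n) ℝ}

theorem IsSUBForm.isStable (h : IsSUBForm A S U B) : IsStable A := by
  obtain ⟨φ, hφ, hT⟩ := h.exists_seminorm
  refine fun μ hμ => ⟨(norm_eigenvalue_le hφ hT hμ).trans h.norm_le_one, fun h1 => ⟨hμ, ?_⟩⟩
  exact maxGenEigenspace_eq_eigenspace_of_contraction hφ
    (fun v => (hT v).trans (mul_le_of_le_one_left (norm_nonneg _) h.norm_le_one)) h1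

theorem IsSUBForm.isAsymptoticallyStable (h : IsSUBForm A S U B) (hB : ‖B‖ < 1) :
    IsAsymptoticallyStable A := by
  obtain ⟨φ, hφ, hT⟩ := h.exists_seminorm
  exact fun μ hμ => (norm_eigenvalue_le hφ hT hμ).trans_lt hB

theorem IsAsymptoticallyStable.isStable (h : IsAsymptoticallyStable A) : IsStable A :=
  fun μ hμ => ⟨(h μ hμ).le, fun h1 => absurd h1 (h μ hμ).ne⟩

theorem IsStable.exists_isSUBForm (hA : IsStable A) :
    ∃ S U B : Matrix (Fin n) (Fin n) ℝ, IsSUBForm A S U B ∧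
      (IsAsymptoticallyStable A → ‖B‖ < 1) := by
  obtain ⟨P, c, hP, hc0, hc1, hc, hle⟩ := hA.exists_posDef
  obtain ⟨S, U, B, h, hB⟩ := exists_isSUBForm_of_posDef hP hc0 hc1 hle
  refine ⟨S, U, B, h, fun has => hB.trans_lt ?_⟩
  rw [Real.sqrt_lt' one_pos, one_pow]
  exact hc has

end Main

end DiscreteTime

theorem theorem1 {n : ℕ} (A : Matrix (Fin n) (Fin n) ℝ) :
    (DiscreteTime.IsStable A ↔
      ∃ S U B : Matrix (Fin n) (Fin n) ℝ, DiscreteTime.IsSUBForm A S U B) ∧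
    (DiscreteTime.IsAsymptoticallyStable A ↔
      ∃ S U B : Matrix (Fin n) (Fin n) ℝ, DiscreteTime.IsSUBForm A S U B ∧ ‖B‖ < 1) := by
  refine ⟨⟨fun h => ?_, fun ⟨S, U, B, h⟩ => h.isStable⟩,
    ⟨fun h => ?_, fun ⟨S, U, B, h, hB⟩ => h.isAsymptoticallyStable hB⟩⟩
  · obtain ⟨S, U, B, hSUB, -⟩ := h.exists_isSUBForm
    exact ⟨S, U, B, hSUB⟩
  · obtain ⟨S, U, B, hSUB, hB⟩ := h.isStable.exists_isSUBForm
    exact ⟨S, U, B, hSUB, hB h⟩
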